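/- Fix integers $0<k<n$. Let $G(k,n)$ be the set of $k$-dimensional linear subspaces of $\mathbb{R}^n$ with the metric $d(V,W)=\|\pi_V-\pi_W\|$ (operator norm), where $\pi_V:\mathbb{R}^n\to V$ is the orthogonal projection, and let $\dim$ denote Hausdorff dimension. For a Borel set $A\subset\mathbb{R}^n$ and $s>0$ put \[ E_s(A):=\{V\in G(k,n):\dim(\pi_V(A))<s\}, \] and for $0<a<n$ and $0<s\le\min\{k,a\}$ define \[ T(a,s):=\sup_{A\subset\mathbb{R}^n\text{ Borel},\ \dim(A)=a}\dim(E_s(A)). \] Write $d(p,q)=p(q-p)$ (the dimension of $G(p,q)$). Let $0<a<n$, $0<s\le\min\{k,a\}$, and write $a=m+\beta$, $s=l+\gamma$ where $m,l\ge 0$ are integers and $\beta,\gamma\in(0,1]$. Then the following lower bounds hold. Type 1: if $1\le m\le n+l-k$ and $\gamma>\frac{\beta+1}{2}$, then \[ T(a,s)\ge d(k-l,n-m)+d(l,n-(k-l))+2\gamma-(\beta+1)=k(n-k)-(m-l)(k-l)+2\gamma-(\beta+1). \] Type 2: if $m\le n+l-k$ and $\gamma>\beta$, then \[ T(a,s)\ge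 d(k-l,n-m)+d(l,n-(k-l))=k(n-k)-(m-l)(k-l). \] Type 3: if $m\le n+l-k-1$ and $\gamma>\frac{\beta}{2}$, then \[ T(a,s)\ge d(k-l,n-m-1)+d(l,n-(k-l))+2\gamma-\beta=k(n-k)-(m+1-l)(k-l)+2\gamma-\beta. \] Type 4: if $l\ge 1$ and $m\le n+l-k-1$, then \[ T(a,s)\ge d(k-(l-1),n-m)+d(l-1,n-(k-l+1))=k(n-k)-(m-l+1)(k-l+1). \] -/

import Mathlib

/-- The Grassmannian `G(k,n)`: the set of `k`-dimensional linear subspaces of `ℝⁿ`. -/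
def EuclideanGrassmannian (k n : ℕ) : Type :=
  {V : Submodule ℝ (EuclideanSpace ℝ (Fin n)) // Module.finrank ℝ V = k}

namespace EuclideanGrassmannian

/-- The orthogonal projection `π_V : ℝⁿ → V ⊆ ℝⁿ` onto `V ∈ G(k,n)`. -/
noncomputable def proj {k n : ℕ} (V : EuclideanGrassmannian k n) :
    EuclideanSpace ℝ (Fin n) →L[ℝ] EuclideanSpace ℝ (Fin n) :=
  V.1.starProjection

theorem proj_injective (k n : ℕ) :
    Function.Injective (proj : EuclideanGrassmannian k n → _) := by
  intro V W h
  apply Subtype.ext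
  have h1 : V.1.starProjection = W.1.starProjection := h
  rw [← Submodule.range_starProjection V.1, ← Submodule.range_starProjection W.1, h1]

/-- The metric `d(V, W) = ‖π_V - π_W‖` (operator norm) on `G(k,n)`. -/
noncomputable instance (k n : ℕ) : MetricSpace (EuclideanGrassmannian k n) :=
  MetricSpace.induced proj (proj_injective k n) inferInstance

theorem dist_eq {k n : ℕ} (V W : EuclideanGrassmannian k n) :
    dist V W = ‖proj V - proj W‖ :=
  dist_eq_norm (proj V) (proj W)

end EuclideanGrassmannian

/-- The exceptional set `E_s(A) = {V ∈ G(k,n) : dim π_V(A) < s}`, with `dim` the Hausdorff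
dimension. -/
noncomputable def exceptionalSet (k : ℕ) {n : ℕ} (s : ℝ) (A : Set (EuclideanSpace ℝ (Fin n))) :
    Set (EuclideanGrassmannian k n) :=
  {V | dimH (V.proj '' A) < ENNReal.ofReal s}

/-- `T(a,s)`, for projections from `ℝⁿ` to `k`-dimensional subspaces: the supremum of
`dim E_s(A)` over all Borel sets `A ⊆ ℝⁿ` with `dim A = a`. -/
noncomputable def exceptionalDim (k n : ℕ) (a s : ℝ) : ENNReal :=
  ⨆ (A : Set (EuclideanSpace ℝ (Fin n))) (_ : MeasurableSet A) (_ : dimH A = ENNReal.ofReal a),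
    dimH (exceptionalSet k s A)

/-- `d(p,q) = p (q - p)`, the dimension of the Grassmannian `G(p,q)`. -/
def grassmannianDim (p q : ℤ) : ℤ := p * (q - p)

/-! Every example is a box of digit sets. The set `gapSet α` consists of the reals in `[0, 1]` with
a binary expansion vanishing on each block `[⌊α j!⌋, j!)`. At scale `2 ^ (-j!)` it needs only about
`2 ^ (α j!)` intervals. Factorials grow so fast that the density of free digits below any position
never falls much under `α`, so random free digits give the matching lower bound. All boxes are thin
at the same scales, hence dimensions of products add (`dimH_pi_gapSet`).

Planes are taken as row spaces of matrices `[1 | M]`. On matrices with entries in `[0, 1]`, `M`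
depends in a Lipschitz way on the plane, so a box of matrices yields a set of planes of at least its
dimension. Projecting to the plane amounts, up to a linear isomorphism, to pairing with the rows.
Number the rows from zero. If the rows after row `l` pair to zero with a box `A`, and row `l` takes
values in a set with covering exponent `γ'`, then the projection has dimension at most `l + γ'`
(`le_exceptionalDim_of_gapBox`).

Two choices of boxes suffice. The cylinder (`le_exceptionalDim_cylinder`) puts a one-dimensional
fractal in row `l` and gives Types 2 and 4. The planar example (`le_exceptionalDim_planar`) rests on
`y + t * x` with `x ∈ gapSet κ`, `t ∈ gapSet μ`, `y ∈ gapSet (κ + μ)`. Truncations of `t * x` lie on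
the same dyadic grid as those of `y`, so the sums keep exponent `κ + μ`, although `(x, y)` ranges
over dimension `2κ + μ`; the entry `t` adds `μ` to the dimension of the planes. Solving `2κ + μ = β`
and letting `κ + μ` increase to `γ` gives Type 3 for `γ ≤ β`, and Type 1 after replacing `(m, β)` by
`(m - 1, β + 1)`. Type 3 with `γ > β` follows from Types 1 and 2. -/

open MeasureTheory Filter Topology
open scoped ENNReal NNReal Nat

/-! ### Box-type covers at factorial scales -/

/-- At every scale `2 ^ (-j!)` the set `E` is covered by at most `C * 2 ^ (σ * j!)` balls of
radius `C * 2 ^ (-j!)`. -/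
def HasFactorialCovers {X : Type*} [PseudoMetricSpace X] (σ : ℝ) (E : Set X) : Prop :=
  ∃ C : ℝ, 0 < C ∧ ∀ j : ℕ, ∃ F : Finset X, (F.card : ℝ) ≤ C * (2 : ℝ) ^ (σ * (j ! : ℝ)) ∧
    ∀ x ∈ E, ∃ y ∈ F, dist x y ≤ C / 2 ^ (j !)

namespace HasFactorialCovers

variable {X Y : Type*} [PseudoMetricSpace X] [PseudoMetricSpace Y] {σ τ : ℝ} {E : Set X}

theorem mono_set {E' : Set X} (h : HasFactorialCovers σ E) (hE : E' ⊆ E) :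
    HasFactorialCovers σ E' := by
  obtain ⟨C, hC, H⟩ := h
  refine ⟨C, hC, fun j => ?_⟩
  obtain ⟨F, hF, hc⟩ := H j
  exact ⟨F, hF, fun x hx => hc x (hE hx)⟩

theorem mono_exponent (h : HasFactorialCovers σ E) (hst : σ ≤ τ) :
    HasFactorialCovers τ E := by
  obtain ⟨C, hC, H⟩ := h
  refine ⟨C, hC, fun j => ?_⟩
  obtain ⟨F, hF, hc⟩ := H j
  refine ⟨F, hF.trans ?_, hc⟩
  gcongr
  norm_num

theorem image (h : HasFactorialCovers σ E) {f : X → Y} {K : ℝ≥0} (hf : LipschitzWith K f) :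
    HasFactorialCovers σ (f '' E) := by
  classical
  obtain ⟨C, hC, H⟩ := h
  refine ⟨(K + 1) * C, by positivity, fun j => ?_⟩
  obtain ⟨F, hF, hc⟩ := H j
  refine ⟨F.image f, ?_, ?_⟩
  · calc ((F.image f).card : ℝ) ≤ F.card := by exact_mod_cast Finset.card_image_le
      _ ≤ 1 * C * (2 : ℝ) ^ (σ * (j ! : ℝ)) := by simpa using hF
      _ ≤ _ := by gcongr; simp
  · rintro _ ⟨x, hx, rfl⟩
    obtain ⟨y, hy, hxy⟩ := hc x hx
    refine ⟨f y, Finset.mem_image_of_mem _ hy, (hf.dist_le_mul x y).trans ?_⟩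
    calc (K : ℝ) * dist x y ≤ (K + 1) * (C / 2 ^ (j !)) := by gcongr; simp
      _ = _ := by ring

/-- Both factors are covered efficiently at the same scales, so the covers multiply. Fixing the
scales once for all sets is what makes exponents additive. -/
theorem prod {E' : Set Y} (h : HasFactorialCovers σ E) (h' : HasFactorialCovers τ E') :
    HasFactorialCovers (σ + τ) (E ×ˢ E') := by
  obtain ⟨C, hC, H⟩ := h
  obtain ⟨C', hC', H'⟩ := h'
  refine ⟨C * C' + C + C', by positivity, fun j => ?_⟩
  obtain ⟨F, hF, hc⟩ := H j
  obtain ⟨F', hF', hc'⟩ := H' j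
  refine ⟨F ×ˢ F', ?_, ?_⟩
  · rw [Finset.card_product, Nat.cast_mul, add_mul σ τ, Real.rpow_add two_pos]
    calc (F.card : ℝ) * F'.card
        ≤ (C * (2 : ℝ) ^ (σ * (j ! : ℝ))) * (C' * (2 : ℝ) ^ (τ * (j ! : ℝ))) := by gcongr
      _ = (C * C' + 0 + 0) * ((2 : ℝ) ^ (σ * (j ! : ℝ)) * (2 : ℝ) ^ (τ * (j ! : ℝ))) := by ring
      _ ≤ _ := by gcongr
  · rintro ⟨x, x'⟩ ⟨hx, hx'⟩
    obtain ⟨y, hy, hxy⟩ := hc x hx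
    obtain ⟨y', hy', hxy'⟩ := hc' x' hx'
    refine ⟨(y, y'), Finset.mk_mem_product hy hy', ?_⟩
    rw [Prod.dist_eq]
    refine max_le (hxy.trans ?_) (hxy'.trans ?_)
    · gcongr
      nlinarith [mul_pos hC hC']
    · gcongr
      nlinarith [mul_pos hC hC']

theorem pi {ι : Type*} [Fintype ι] {X : ι → Type*} [∀ i, PseudoMetricSpace (X i)] {σ : ι → ℝ}
    {E : ∀ i, Set (X i)} (h : ∀ i, HasFactorialCovers (σ i) (E i)) :
    HasFactorialCovers (∑ i, σ i) (Set.univ.pi E) := by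
  classical
  choose C hC H using h
  refine ⟨∏ i, C i + ∑ i, C i + 1, ?_, fun j => ?_⟩
  · have := Finset.prod_pos (s := Finset.univ) fun i _ => hC i
    have := Finset.sum_nonneg (s := Finset.univ) fun i _ => (hC i).le
    linarith
  have hp := Finset.prod_pos (s := Finset.univ) fun i _ => hC i
  have hs := Finset.sum_nonneg (s := Finset.univ) fun i _ => (hC i).le
  choose F hF hc using fun i => H i j
  refine ⟨Fintype.piFinset F, ?_, fun x hx => ?_⟩
  · rw [Fintype.card_piFinset, Nat.cast_prod, Finset.sum_mul,
      Real.rpow_sum_of_pos two_pos]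
    calc ∏ i, ((F i).card : ℝ) ≤ ∏ i, (C i * (2 : ℝ) ^ (σ i * (j ! : ℝ))) :=
          Finset.prod_le_prod (fun _ _ => by positivity) fun i _ => hF i
      _ = (∏ i, C i) * ∏ i, (2 : ℝ) ^ (σ i * (j ! : ℝ)) := Finset.prod_mul_distrib
      _ ≤ _ := by
        refine mul_le_mul_of_nonneg_right (by linarith) (Finset.prod_nonneg fun _ _ => ?_)
        positivity
  · choose y hy hxy using fun i => hc i (x i) (hx i (Set.mem_univ i))
    refine ⟨y, Fintype.mem_piFinset.2 hy, (dist_pi_le_iff (by positivity)).2 fun i => ?_⟩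
    refine (hxy i).trans ?_
    gcongr
    have := Finset.single_le_sum (f := C) (fun i _ => (hC i).le) (Finset.mem_univ i)
    linarith

theorem Icc_real (a b : ℝ) : HasFactorialCovers 1 (Set.Icc a b) := by
  classical
  refine ⟨|b - a| + 2, by positivity, fun j => ?_⟩
  set δ : ℝ := 2 ^ (j !) with hδ
  have hδ1 : 1 ≤ δ := one_le_pow₀ (by norm_num)
  refine ⟨(Finset.range (⌊|b - a| * δ⌋₊ + 1)).image fun q : ℕ => a + q / δ, ?_, ?_⟩
  · rw [one_mul, Real.rpow_natCast, ← hδ]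
    refine (Nat.cast_le.2 Finset.card_image_le).trans ?_
    rw [Finset.card_range]
    push_cast
    have := Nat.floor_le (show 0 ≤ |b - a| * δ by positivity)
    nlinarith
  · rintro x ⟨hx, hx'⟩
    have h0 : 0 ≤ (x - a) * δ := mul_nonneg (by linarith) (by positivity)
    refine ⟨a + ⌊(x - a) * δ⌋₊ / δ, Finset.mem_image_of_mem (fun q : ℕ => a + q / δ) ?_, ?_⟩
    · rw [Finset.mem_range, Nat.lt_succ_iff]
      apply Nat.floor_le_floor
      gcongr
      exact (by linarith : x - a ≤ b - a).trans (le_abs_self _)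
    · have h1 := Nat.floor_le h0
      have h2 := Nat.lt_floor_add_one ((x - a) * δ)
      rw [Real.dist_eq, le_div_iff₀ (by positivity), ← abs_of_pos (show 0 < δ by positivity),
        ← abs_mul, abs_of_pos (show 0 < δ by positivity)]
      have : (x - (a + ⌊(x - a) * δ⌋₊ / δ)) * δ = (x - a) * δ - ⌊(x - a) * δ⌋₊ := by
        field_simp
        ring
      rw [this, abs_of_nonneg (by linarith)]
      have := abs_nonneg (b - a)
      linarith

/-- Covers at infinitely many scales bound the Hausdorff dimension. -/
theorem dimH_le {X : Type*} [MetricSpace X] {E : Set X} (h : HasFactorialCovers σ E) :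
    dimH E ≤ ENNReal.ofReal σ := by
  borelize X
  obtain ⟨C, hC, H⟩ := h
  refine _root_.dimH_le fun d hd => ?_
  by_contra hlt
  rw [not_le] at hlt
  have hσd : σ < d := by
    rcases le_or_gt 0 σ with h0 | h0
    · rwa [← ENNReal.ofReal_coe_nnreal, ENNReal.ofReal_lt_ofReal_iff_of_nonneg h0] at hlt
    · exact h0.trans_le d.2
  choose F hF hc using H
  have hfac : Tendsto (fun j : ℕ => (j ! : ℝ)) atTop atTop :=
    tendsto_natCast_atTop_atTop.comp factorial_tendsto_atTop
  have hr : Tendsto (fun j : ℕ => ENNReal.ofReal (2 * (C / 2 ^ (j !)))) atTop (𝓝 0) := by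
    rw [← ENNReal.ofReal_zero]
    refine ENNReal.tendsto_ofReal ?_
    have : Tendsto (fun j : ℕ => (2 : ℝ) ^ (j !)) atTop atTop :=
      (tendsto_pow_atTop_atTop_of_one_lt one_lt_two).comp factorial_tendsto_atTop
    simpa using (this.const_div_atTop C).const_mul 2
  have hball : ∀ (j : ℕ) (y : X),
      Metric.ediam (Metric.closedBall y (C / 2 ^ (j !))) ≤
        ENNReal.ofReal (2 * (C / 2 ^ (j !))) := by
    intro j y
    refine Metric.ediam_le_of_forall_dist_le fun a ha b hb => ?_
    have h1 := Metric.mem_closedBall.1 ha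
    have h2 := Metric.mem_closedBall'.1 hb
    linarith [dist_triangle a y b]
  -- Any sequence of covers with mesh tending to zero bounds the Hausdorff measure, so the sparse
  -- scales `2 ^ (-j!)` are enough. For `d > σ` the sums are `O(2 ^ ((σ - d) j!))`.
  have key := Measure.hausdorffMeasure_le_liminf_sum (d : ℝ) E (l := atTop) _ hr
    (fun (j : ℕ) (y : F j) => Metric.closedBall (y : X) (C / 2 ^ (j !)))
    (.of_forall fun j y => hball j y)
    (.of_forall fun j x hx => by
      obtain ⟨y, hy, hxy⟩ := hc j x hx
      exact Set.mem_iUnion.2 ⟨⟨y, hy⟩, hxy⟩)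
  have hbound : ∀ j : ℕ, (∑ y : F j, Metric.ediam (Metric.closedBall (y : X) (C / 2 ^ (j !)))
      ^ (d : ℝ)) ≤ ENNReal.ofReal (C * (2 * C) ^ (d : ℝ) * (2 : ℝ) ^ ((σ - d) * (j ! : ℝ))) := by
    intro j
    calc _ ≤ ∑ _y : F j, ENNReal.ofReal (2 * (C / 2 ^ (j !))) ^ (d : ℝ) :=
          Finset.sum_le_sum fun y _ => ENNReal.rpow_le_rpow (hball j y) d.2
      _ = ENNReal.ofReal ((F j).card * (2 * (C / 2 ^ (j !))) ^ (d : ℝ)) := by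
          rw [Finset.sum_const, Finset.card_univ, Fintype.card_coe, nsmul_eq_mul,
            ENNReal.ofReal_rpow_of_nonneg (by positivity) d.coe_nonneg,
            ENNReal.ofReal_mul (by positivity), ENNReal.ofReal_natCast]
      _ ≤ _ := by
          apply ENNReal.ofReal_le_ofReal
          calc _ ≤ C * (2 : ℝ) ^ (σ * (j ! : ℝ)) * (2 * (C / 2 ^ (j !))) ^ (d : ℝ) := by
                gcongr
                exact hF j
            _ = _ := by
                rw [← mul_div_assoc, Real.div_rpow (by positivity) (by positivity),
                  ← Real.rpow_natCast, ← Real.rpow_mul (by norm_num), sub_mul,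
                  Real.rpow_sub two_pos, mul_comm (j ! : ℝ)]
                ring
  have hlim : Tendsto (fun j : ℕ => ENNReal.ofReal
      (C * (2 * C) ^ (d : ℝ) * (2 : ℝ) ^ ((σ - d) * (j ! : ℝ)))) atTop (𝓝 0) := by
    rw [← ENNReal.ofReal_zero]
    refine ENNReal.tendsto_ofReal ?_
    have : Tendsto (fun j : ℕ => (2 : ℝ) ^ ((σ - d) * (j ! : ℝ))) atTop (𝓝 0) :=
      (tendsto_rpow_atBot_of_base_gt_one 2 one_lt_two).comp
        (hfac.const_mul_atTop_of_neg (by linarith))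
    simpa using this.const_mul (C * (2 * C) ^ (d : ℝ))
  have hz : μH[(d : ℝ)] E ≤ 0 := by
    refine key.trans ?_
    rw [← hlim.liminf_eq]
    exact liminf_le_liminf (.of_forall hbound)
  rw [hd] at hz
  simp at hz

end HasFactorialCovers

/-! ### The mass distribution principle -/

/-- If every set of diameter at most `2 ^ (-N)` has mass at most `C * 2 ^ (-σ * N)`, then every set
of positive mass has Hausdorff dimension at least `σ`. -/
theorem le_dimH_of_measure_le {X : Type*} [MetricSpace X] [MeasurableSpace X] [BorelSpace X]
    (μ : Measure X) {σ C : ℝ} (hC : 0 < C)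
    (h : ∀ (N : ℕ) (U : Set X), Metric.ediam U ≤ ENNReal.ofReal (1 / 2 ^ N) →
      μ U ≤ ENNReal.ofReal (C * (2 : ℝ) ^ (-σ * N)))
    {E : Set X} (hE : μ E ≠ 0) : ENNReal.ofReal σ ≤ dimH E := by
  rcases le_or_gt σ 0 with h0 | h0
  · simp [ENNReal.ofReal_of_nonpos h0]
  lift σ to ℝ≥0 using h0.le
  rw [ENNReal.ofReal_coe_nnreal]
  apply le_dimH_of_hausdorffMeasure_ne_zero
  -- The factor `2 ^ σ` pays for rounding a diameter up to a power of `1 / 2`.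
  set D : ℝ := C * 2 ^ (σ : ℝ) with hD
  have hDpos : 0 < D := by positivity
  have hle : (ENNReal.ofReal D)⁻¹ • μ ≤ μH[(σ : ℝ)] := by
    refine Measure.le_hausdorffMeasure _ _ 1 one_pos fun U hU => ?_
    rw [Measure.smul_apply, smul_eq_mul, mul_comm, ← div_eq_mul_inv]
    apply ENNReal.div_le_of_le_mul
    -- A set of diameter zero has no nearest dyadic scale; its mass is zero by letting `N → ∞`.
    rcases eq_or_ne (Metric.ediam U) 0 with hU0 | hU0
    · have hlim : Tendsto (fun N : ℕ => ENNReal.ofReal (C * (2 : ℝ) ^ (-(σ : ℝ) * N))) atTop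
          (𝓝 0) := by
        rw [← ENNReal.ofReal_zero]
        refine ENNReal.tendsto_ofReal ?_
        have : Tendsto (fun N : ℕ => (2 : ℝ) ^ (-(σ : ℝ) * N)) atTop (𝓝 0) :=
          (tendsto_rpow_atBot_of_base_gt_one 2 one_lt_two).comp
            (tendsto_natCast_atTop_atTop.const_mul_atTop_of_neg (by linarith))
        simpa using this.const_mul C
      have : μ U ≤ 0 := ge_of_tendsto' hlim fun N => h N U (by simp [hU0])
      exact this.trans zero_le
    · have hfin : Metric.ediam U ≠ ∞ := ne_top_of_le_ne_top ENNReal.one_ne_top hU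
      set δ := (Metric.ediam U).toReal with hδ
      have hδU : Metric.ediam U = ENNReal.ofReal δ := (ENNReal.ofReal_toReal hfin).symm
      have hδ0 : 0 < δ := ENNReal.toReal_pos hU0 hfin
      have hδ1 : δ ≤ 1 := by
        rw [hδ]; exact ENNReal.toReal_le_of_le_ofReal zero_le_one (by simpa using hU)
      obtain ⟨N, hN1, hN2⟩ := exists_nat_pow_near_of_lt_one hδ0 hδ1
        (show (0 : ℝ) < 1 / 2 by norm_num) (by norm_num)
      refine (h N U ?_).trans ?_
      · rw [hδU]
        apply ENNReal.ofReal_le_ofReal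
        rwa [one_div_pow] at hN2
      · rw [hδU, ENNReal.ofReal_rpow_of_pos hδ0, mul_comm (ENNReal.ofReal _),
          ← ENNReal.ofReal_mul hDpos.le]
        apply ENNReal.ofReal_le_ofReal
        calc C * (2 : ℝ) ^ (-(σ : ℝ) * N)
            = D * (((1 / 2 : ℝ) ^ (N + 1)) ^ (σ : ℝ)) := by
              rw [hD, ← Real.rpow_natCast, ← Real.rpow_mul (by norm_num), one_div,
                Real.inv_rpow (by norm_num), ← Real.rpow_neg (by norm_num), mul_assoc,
                ← Real.rpow_add two_pos]
              congr 2
              push_cast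
              ring
          _ ≤ _ := by gcongr
  intro hz
  have : ((ENNReal.ofReal D)⁻¹ • μ) E ≤ 0 := (hle E).trans hz.le
  simp [hE] at this

/-! ### Sets of binary expansions with prescribed zero digits -/

/-- The integer with binary digits `d 0, …, d (N - 1)`, most significant digit first. -/
def binaryPrefix (d : ℕ → Fin 2) : ℕ → ℕ
  | 0 => 0
  | N + 1 => 2 * binaryPrefix d N + d N

theorem binaryPrefix_lt (d : ℕ → Fin 2) (N : ℕ) : binaryPrefix d N < 2 ^ N := by
  induction N with
  | zero => simp [binaryPrefix]
  | succ N ih =>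
    have := (d N).isLt
    simp only [binaryPrefix, pow_succ]
    omega

theorem binaryPrefix_injective {d d' : ℕ → Fin 2} {N : ℕ}
    (h : binaryPrefix d N = binaryPrefix d' N) {i : ℕ} (hi : i < N) : d i = d' i := by
  induction N with
  | zero => omega
  | succ N ih =>
    have h1 := (d N).isLt
    have h2 := (d' N).isLt
    simp only [binaryPrefix] at h
    rcases Nat.lt_succ_iff_lt_or_eq.1 hi with h' | rfl
    · exact ih (by omega) h'
    · exact Fin.ext (by omega)

theorem sum_ofDigitsTerm_eq_binaryPrefix (d : ℕ → Fin 2) (N : ℕ) :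
    ∑ i ∈ Finset.range N, Real.ofDigitsTerm d i = binaryPrefix d N / 2 ^ N := by
  induction N with
  | zero => simp [binaryPrefix]
  | succ N ih =>
    rw [Finset.sum_range_succ, ih]
    simp only [binaryPrefix, Real.ofDigitsTerm]
    push_cast
    field_simp
    ring

theorem ofDigits_mem_Icc_binaryPrefix (d : ℕ → Fin 2) (N : ℕ) :
    Real.ofDigits d ∈ Set.Icc (binaryPrefix d N / 2 ^ N : ℝ)
      (binaryPrefix d N / 2 ^ N + 1 / 2 ^ N) := by
  rw [Real.ofDigits_eq_sum_add_ofDigits d N, sum_ofDigitsTerm_eq_binaryPrefix]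
  have h0 := Real.ofDigits_nonneg fun i => d (i + N)
  have h1 := Real.ofDigits_le_one fun i => d (i + N)
  have hp : (0 : ℝ) < ((2 : ℕ) ^ N : ℝ)⁻¹ := by positivity
  constructor
  · nlinarith
  · rw [one_div]
    push_cast at hp ⊢
    nlinarith

theorem binaryPrefix_eq_mul_of_zero {d : ℕ → Fin 2} {κ N : ℕ} (hκ : κ ≤ N)
    (h : ∀ i, κ ≤ i → i < N → d i = 0) : binaryPrefix d N = 2 ^ (N - κ) * binaryPrefix d κ := by
  induction N, hκ using Nat.le_induction with
  | base => simp
  | succ N hN ih =>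
    simp only [binaryPrefix]
    rw [ih fun i hi hi' => h i hi (by omega), h N hN (by omega), Nat.succ_sub hN, pow_succ]
    simp
    ring

/-- The reals in `[0, 1]` having a binary expansion which vanishes at the positions in `R`. -/
def zeroDigitSet (R : Set ℕ) : Set ℝ := Real.ofDigits '' {d : ℕ → Fin 2 | ∀ i ∈ R, d i = 0}

theorem isCompact_zeroDigitSet (R : Set ℕ) : IsCompact (zeroDigitSet R) := by
  refine IsCompact.image (IsClosed.isCompact ?_) Real.continuous_ofDigits
  simp only [Set.ofPred_forall]
  exact isClosed_iInter fun i => isClosed_iInter fun _ =>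
    isClosed_eq (continuous_apply i) continuous_const

theorem zeroDigitSet_subset_Icc (R : Set ℕ) : zeroDigitSet R ⊆ Set.Icc 0 1 := by
  rintro _ ⟨d, -, rfl⟩
  exact ⟨Real.ofDigits_nonneg d, Real.ofDigits_le_one d⟩

open Classical in
/-- Replace the digits at the positions in `R` by zero. -/
noncomputable def maskDigits (R : Set ℕ) (d : ℕ → Fin 2) (i : ℕ) : Fin 2 := if i ∈ R then 0 else d i

theorem measurable_maskDigits (R : Set ℕ) : Measurable (maskDigits R) := by
  refine measurable_pi_lambda _ fun i => ?_
  unfold maskDigits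
  split_ifs <;> fun_prop

/-- The law of independent fair binary digits. -/
noncomputable def fairDigits : Measure (ℕ → Fin 2) :=
  Measure.infinitePi fun _ => ProbabilityTheory.uniformOn Set.univ

instance : IsProbabilityMeasure fairDigits := by
  unfold fairDigits
  have : IsProbabilityMeasure (ProbabilityTheory.uniformOn (Set.univ : Set (Fin 2))) :=
    ProbabilityTheory.isProbabilityMeasure_uniformOn Set.finite_univ Set.univ_nonempty
  infer_instance

/-- The law of a random real whose binary digits are zero on `R` and fair off `R`. -/
noncomputable def zeroDigitMeasure (R : Set ℕ) : Measure ℝ :=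
  fairDigits.map fun d => Real.ofDigits (maskDigits R d)

theorem measurable_ofDigits_maskDigits (R : Set ℕ) :
    Measurable fun d => Real.ofDigits (maskDigits R d) :=
  Real.continuous_ofDigits.measurable.comp (measurable_maskDigits R)

instance (R : Set ℕ) : IsProbabilityMeasure (zeroDigitMeasure R) :=
  Measure.isProbabilityMeasure_map (measurable_ofDigits_maskDigits R).aemeasurable

theorem zeroDigitMeasure_zeroDigitSet (R : Set ℕ) : zeroDigitMeasure R (zeroDigitSet R) = 1 := by
  rw [zeroDigitMeasure, Measure.map_apply (measurable_ofDigits_maskDigits R)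
    (isCompact_zeroDigitSet R).measurableSet, ← measure_univ (μ := fairDigits)]
  congr
  refine Set.eq_univ_of_forall fun d => ⟨_, fun i hi => ?_, rfl⟩
  simp [maskDigits, hi]

open Classical in
/-- The number of positions below `N` that are not in `R`. -/
noncomputable def freeCount (R : Set ℕ) (N : ℕ) : ℕ := ((Finset.range N).filter (· ∉ R)).card

/-- A prefix determines its digits, so the event fixes every free digit below `N`, and each of these
independently costs a factor `1 / 2`. -/
theorem fairDigits_binaryPrefix_le (R : Set ℕ) (N q : ℕ) :
    fairDigits {d | binaryPrefix (maskDigits R d) N = q} ≤ ENNReal.ofReal (1 / 2 ^ freeCount R N) := by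
  classical
  rcases Set.eq_empty_or_nonempty {d | binaryPrefix (maskDigits R d) N = q} with h | ⟨d₀, h₀⟩
  · simp [h]
  have : IsProbabilityMeasure (ProbabilityTheory.uniformOn (Set.univ : Set (Fin 2))) :=
    ProbabilityTheory.isProbabilityMeasure_uniformOn Set.finite_univ Set.univ_nonempty
  calc _ ≤ fairDigits (Set.pi ((Finset.range N).filter (· ∉ R)) fun i => {d₀ i}) := by
        refine measure_mono fun d hd i hi => ?_
        simp only [Finset.coe_filter, Finset.mem_range, Set.mem_ofPred_eq] at hi
        have := binaryPrefix_injective (hd.trans (Set.mem_ofPred_eq.mp h₀).symm) hi.1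
        simpa [maskDigits, hi.2] using this
    _ = ∏ i ∈ (Finset.range N).filter (· ∉ R), (2 : ℝ≥0∞)⁻¹ := by
        rw [fairDigits, Measure.infinitePi_pi _ fun i _ => measurableSet_singleton _]
        refine Finset.prod_congr rfl fun i _ => ?_
        simp [ProbabilityTheory.uniformOn_univ]
    _ = _ := by
        rw [Finset.prod_const, one_div, ENNReal.ofReal_inv_of_pos (by positivity),
          ENNReal.ofReal_pow (by norm_num), ENNReal.inv_pow]
        simp [freeCount]

theorem zeroDigitMeasure_closedBall_le (R : Set ℕ) (u : ℝ) (N : ℕ) :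
    zeroDigitMeasure R (Metric.closedBall u (1 / 2 ^ N)) ≤
      ENNReal.ofReal (4 * (1 / 2 ^ freeCount R N)) := by
  rw [zeroDigitMeasure, Measure.map_apply (measurable_ofDigits_maskDigits R)
    Metric.isClosed_closedBall.measurableSet]
  -- A prefix `q` occurring in the ball satisfies `u 2^N - 2 ≤ q ≤ u 2^N + 1`, which leaves at most
  -- four values. Clipping the ceiling at zero is harmless because `q` is natural.
  set z : ℕ := ⌈u * 2 ^ N - 2⌉₊ with hz
  calc _ ≤ fairDigits (⋃ q ∈ Finset.Icc z (z + 3), {d | binaryPrefix (maskDigits R d) N = q}) := by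
        refine measure_mono fun d hd => ?_
        simp only [Set.mem_preimage, Metric.mem_closedBall, Real.dist_eq, abs_le] at hd
        obtain ⟨h1, h2⟩ := ofDigits_mem_Icc_binaryPrefix (maskDigits R d) N
        simp only [Set.mem_iUnion, Set.mem_ofPred_eq, exists_prop, exists_eq_right', Finset.mem_Icc]
        have hp : (0 : ℝ) < 2 ^ N := by positivity
        have h3 : u ≤ (binaryPrefix (maskDigits R d) N + 2) / 2 ^ N := by
          rw [add_div]
          have : (2 : ℝ) / 2 ^ N = 1 / 2 ^ N + 1 / 2 ^ N := by ring
          linarith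
        have h4 : ((binaryPrefix (maskDigits R d) N : ℝ) - 1) / 2 ^ N ≤ u := by
          rw [sub_div]
          linarith
        rw [le_div_iff₀ hp] at h3
        rw [div_le_iff₀ hp] at h4
        constructor
        · rw [hz, Nat.ceil_le]
          linarith
        · have := Nat.le_ceil (u * 2 ^ N - 2)
          rw [← hz] at this
          have h5 : (binaryPrefix (maskDigits R d) N : ℝ) ≤ (z + 3 : ℕ) := by
            push_cast
            linarith
          exact_mod_cast h5
    _ ≤ ∑ q ∈ Finset.Icc z (z + 3), fairDigits {d | binaryPrefix (maskDigits R d) N = q} :=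
        measure_biUnion_finset_le _ _
    _ ≤ ∑ q ∈ Finset.Icc z (z + 3), ENNReal.ofReal (1 / 2 ^ freeCount R N) :=
        Finset.sum_le_sum fun q _ => fairDigits_binaryPrefix_le R N q
    _ = _ := by
        rw [Finset.sum_const, Nat.card_Icc, nsmul_eq_mul, ENNReal.ofReal_mul (by norm_num)]
        congr 1
        rw [show z + 3 + 1 - z = 4 by omega]
        simp

/-- Lower bound for the Hausdorff dimension of a product of digit sets by the lower density of the
free positions. -/
theorem le_dimH_pi_zeroDigitSet {ι : Type*} [Fintype ι] (R : ι → Set ℕ) {α : ι → ℝ} {C : ℝ}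
    (h : ∀ i N, α i * N - C ≤ freeCount (R i) N) :
    ENNReal.ofReal (∑ i, α i) ≤ dimH (Set.univ.pi fun i => zeroDigitSet (R i)) := by
  refine le_dimH_of_measure_le (Measure.pi fun i => zeroDigitMeasure (R i))
    (C := ∏ _i : ι, 4 * (2 : ℝ) ^ C) (Finset.prod_pos fun _ _ => by positivity) ?_ ?_
  · intro N U hU
    rcases U.eq_empty_or_nonempty with rfl | ⟨x, hx⟩
    · simp
    calc Measure.pi (fun i => zeroDigitMeasure (R i)) U
        ≤ Measure.pi (fun i => zeroDigitMeasure (R i))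
            (Set.univ.pi fun i => Metric.closedBall (x i) (1 / 2 ^ N)) := by
          refine measure_mono fun y hy i _ => ?_
          rw [Metric.mem_closedBall]
          refine (dist_le_pi_dist y x i).trans ?_
          rw [← ENNReal.ofReal_le_ofReal_iff (by positivity), ← edist_dist]
          exact (Metric.edist_le_ediam_of_mem hy hx).trans hU
      _ = ∏ i, zeroDigitMeasure (R i) (Metric.closedBall (x i) (1 / 2 ^ N)) := Measure.pi_pi _ _
      _ ≤ ∏ i, ENNReal.ofReal (4 * (2 : ℝ) ^ C * (2 : ℝ) ^ (-α i * N)) := by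
          refine Finset.prod_le_prod' fun i _ => (zeroDigitMeasure_closedBall_le _ _ _).trans ?_
          apply ENNReal.ofReal_le_ofReal
          rw [mul_assoc, ← Real.rpow_add two_pos, one_div, ← Real.rpow_natCast,
            ← Real.rpow_neg (by norm_num)]
          gcongr
          · norm_num
          · linarith [h i N]
      _ = ENNReal.ofReal (∏ i, (4 * (2 : ℝ) ^ C * (2 : ℝ) ^ (-α i * N))) :=
          (ENNReal.ofReal_prod_of_nonneg fun _ _ => by positivity).symm
      _ = _ := by
          rw [Finset.prod_mul_distrib, ← Real.rpow_sum_of_pos two_pos, ← Finset.sum_mul,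
            Finset.sum_neg_distrib]
  · rw [Measure.pi_pi]
    simp [zeroDigitMeasure_zeroDigitSet]

/-! ### Digit sets with factorial gaps -/

/-- The positions lying in one of the intervals `[⌊α * j!⌋, j!)`. -/
def factorialGaps (α : ℝ) : Set ℕ := {i | ∃ j : ℕ, ⌊α * (j ! : ℝ)⌋₊ ≤ i ∧ i < j !}

/-- The reals in `[0, 1]` having a binary expansion which vanishes on all the intervals
`[⌊α * j!⌋, j!)`. -/
def gapSet (α : ℝ) : Set ℝ := zeroDigitSet (factorialGaps α)

/-- The last digits before position `j!` vanish, so truncating at `⌊α j!⌋` digits is already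
accurate to `2 ^ (-j!)`. -/
theorem exists_dyadic_near_of_mem_gapSet {α : ℝ} (h1 : α ≤ 1) {x : ℝ} (hx : x ∈ gapSet α) (j : ℕ) :
    ∃ q : ℕ, q < 2 ^ ⌊α * (j ! : ℝ)⌋₊ ∧ (q / 2 ^ ⌊α * (j ! : ℝ)⌋₊ : ℝ) ≤ x ∧
      x ≤ (q / 2 ^ ⌊α * (j ! : ℝ)⌋₊ : ℝ) + 1 / 2 ^ (j !) := by
  obtain ⟨d, hd, rfl⟩ := hx
  have hκ : ⌊α * (j ! : ℝ)⌋₊ ≤ j ! :=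
    Nat.floor_le_of_le (mul_le_of_le_one_left (by positivity) h1)
  have h := ofDigits_mem_Icc_binaryPrefix d (j !)
  rw [binaryPrefix_eq_mul_of_zero hκ fun i hi hi' => hd i ⟨j, hi, hi'⟩] at h
  refine ⟨_, binaryPrefix_lt d _, ?_⟩
  generalize ⌊α * (j ! : ℝ)⌋₊ = κ at *
  have heq : ((2 ^ ((j !) - κ) * binaryPrefix d κ : ℕ) / 2 ^ (j !) : ℝ)
      = binaryPrefix d κ / 2 ^ κ := by
    rw [div_eq_div_iff (by positivity) (by positivity)]
    push_cast
    rw [mul_right_comm, ← pow_add, Nat.sub_add_cancel hκ, mul_comm]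
  rwa [heq] at h

/-- Let `[⌊α i!⌋, i!)` be the last gap starting before `N`. Earlier gaps lie below `(i - 1)!`, which
is negligible against `α i! ≤ N`, and the last one fills at most the proportion `1 - α` of `[0, N)`,
up to rounding. -/
theorem exists_freeCount_factorialGaps_ge {α ε : ℝ} (h0 : 0 ≤ α) (h1 : α ≤ 1) (hε : 0 < ε) :
    ∃ C : ℝ, ∀ N, (α - ε) * N - C ≤ freeCount (factorialGaps α) N := by
  classical
  rcases h0.eq_or_lt with rfl | h0
  · exact ⟨0, fun N => by nlinarith [(Nat.cast_nonneg N : (0 : ℝ) ≤ N), (Nat.cast_nonneg (freeCount (factorialGaps 0) N) : (0 : ℝ) ≤ _)]⟩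
  -- `C₀` bounds `(i - 1)!` while `i ≤ 1 / (α ε)`; for larger `i`, `(i - 1)! = i! / i ≤ ε α i! ≤ ε
  -- N`.
  set C₀ : ℝ := (Nat.factorial ⌈1 / (α * ε)⌉₊ : ℝ) with hC₀
  have hC₀1 : 1 ≤ C₀ := by
    rw [hC₀]
    exact_mod_cast Nat.one_le_iff_ne_zero.2 (Nat.factorial_ne_zero _)
  refine ⟨C₀ + 1, fun N => ?_⟩
  have hN0 : (0 : ℝ) ≤ N := N.cast_nonneg
  have hmono : ∀ {i j : ℕ}, i ≤ j → ⌊α * (i ! : ℝ)⌋₊ ≤ ⌊α * (j ! : ℝ)⌋₊ := fun hij => by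
    gcongr
  have hex : ∃ i, N ≤ ⌊α * (i ! : ℝ)⌋₊ := by
    obtain ⟨i, hi⟩ := exists_nat_ge (N / α : ℝ)
    refine ⟨i, Nat.le_floor ?_⟩
    rw [div_le_iff₀' h0] at hi
    refine hi.trans ?_
    gcongr
    exact i.self_le_factorial
  have hsplit : N ≤ freeCount (factorialGaps α) N +
      ((Finset.range N).filter (· ∈ factorialGaps α)).card := by
    have := Finset.card_filter_add_card_filter_not (s := Finset.range N)
      (fun i => i ∈ factorialGaps α)
    rw [Finset.card_range] at this
    unfold freeCount
    rw [add_comm]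
    refine le_of_eq ?_
    convert this.symm
  have hsplit' : (N : ℝ) ≤ freeCount (factorialGaps α) N +
      ((Finset.range N).filter (· ∈ factorialGaps α)).card := by exact_mod_cast hsplit
  suffices (((Finset.range N).filter (· ∈ factorialGaps α)).card : ℝ) ≤
      (1 - α + ε) * N + (C₀ + 1) by linarith
  obtain ⟨hi₀, hmin⟩ := Nat.find_spec hex, fun m => Nat.find_min hex (m := m)
  generalize Nat.find hex = i₀ at hi₀ hmin
  rcases i₀ with _ | i
  · rw [Finset.filter_false_of_mem]
    · simp only [Finset.card_empty, Nat.cast_zero]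
      nlinarith
    · rintro x hx ⟨j, hj, -⟩
      have := hmono j.zero_le
      have := Finset.mem_range.1 hx
      omega
  · have hi : ⌊α * (i ! : ℝ)⌋₊ < N := not_le.1 (hmin i (Nat.lt_succ_self i))
    set κ := ⌊α * (i ! : ℝ)⌋₊ with hκ
    have hκi : κ ≤ i ! := Nat.floor_le_of_le (mul_le_of_le_one_left (by positivity) h1)
    have hsub : (Finset.range N).filter (· ∈ factorialGaps α) ⊆
        Finset.range ((i - 1)!) ∪ Finset.Ico κ (min N (i !)) := by
      intro x hx
      obtain ⟨hxN, j, hj, hxj⟩ := Finset.mem_filter.1 hx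
      rw [Finset.mem_range] at hxN
      rw [Finset.mem_union, Finset.mem_range, Finset.mem_Ico, lt_min_iff]
      rcases lt_trichotomy j i with h | rfl | h
      · exact .inl (hxj.trans_le (Nat.factorial_le (by omega)))
      · exact .inr ⟨hj, hxN, hxj⟩
      · have := hmono (Nat.succ_le_of_lt h)
        simp only [Nat.succ_eq_add_one] at this
        omega
    have hcard := (Finset.card_le_card hsub).trans (Finset.card_union_le _ _)
    rw [Finset.card_range, Nat.card_Ico] at hcard
    have hcard' : (((Finset.range N).filter (· ∈ factorialGaps α)).card : ℝ) ≤
        ((i - 1)! : ℕ) + ((min N (i !) : ℕ) - κ) := by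
      have hκm : κ ≤ min N (i !) := le_min hi.le hκi
      rw [← Nat.cast_sub hκm]
      exact_mod_cast hcard
    have hfl : α * (i ! : ℝ) < κ + 1 := Nat.lt_floor_add_one _
    have hM1 : ((min N (i !) : ℕ) : ℝ) ≤ N := by exact_mod_cast min_le_left _ _
    have hM2 : ((min N (i !) : ℕ) : ℝ) ≤ (i ! : ℕ) := by exact_mod_cast min_le_right _ _
    have hαN : α * (i ! : ℝ) ≤ N := by
      have : (κ : ℝ) + 1 ≤ N := by exact_mod_cast hi
      linarith
    have hprev : ((i - 1)! : ℝ) ≤ ε * N + C₀ := by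
      rcases le_total (i : ℝ) (1 / (α * ε)) with h | h
      · have : ((i - 1)! : ℝ) ≤ C₀ := by
          rw [hC₀]
          exact_mod_cast Nat.factorial_le ((Nat.sub_le i 1).trans
            (Nat.cast_le.1 (h.trans (Nat.le_ceil _))))
        nlinarith
      · have hipos : i ≠ 0 := by
          rintro rfl
          have : 0 < 1 / (α * ε) := by positivity
          rw [Nat.cast_zero] at h
          linarith
        have hf : (i : ℝ) * ((i - 1)! : ℝ) = i ! := by
          exact_mod_cast Nat.mul_factorial_pred hipos
        rw [div_le_iff₀ (by positivity)] at h
        have hp : (0 : ℝ) ≤ ((i - 1)! : ℝ) := by positivity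
        calc ((i - 1)! : ℝ) = 1 * ((i - 1)! : ℝ) := (one_mul _).symm
          _ ≤ (i * (α * ε)) * ((i - 1)! : ℝ) := by gcongr
          _ = ε * (α * (i * ((i - 1)! : ℝ))) := by ring
          _ ≤ ε * N := by rw [hf]; gcongr
          _ ≤ _ := by linarith
    nlinarith

theorem isCompact_gapSet (α : ℝ) : IsCompact (gapSet α) := isCompact_zeroDigitSet _

theorem gapSet_subset_Icc (α : ℝ) : gapSet α ⊆ Set.Icc 0 1 := zeroDigitSet_subset_Icc _

/-- Density zero is the device for switching off a coordinate of the box or an entry of the matrix.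
-/
theorem gapSet_zero : gapSet 0 ⊆ {0} := by
  intro x hx
  have hlim : Tendsto (fun j : ℕ => (1 : ℝ) / 2 ^ (j !)) atTop (𝓝 0) := by
    have : Tendsto (fun j : ℕ => (2 : ℝ) ^ (j !)) atTop atTop :=
      (tendsto_pow_atTop_atTop_of_one_lt one_lt_two).comp factorial_tendsto_atTop
    exact this.const_div_atTop 1
  refine le_antisymm (ge_of_tendsto' hlim fun j => ?_) (gapSet_subset_Icc _ hx).1
  obtain ⟨q, hq, -, h⟩ := exists_dyadic_near_of_mem_gapSet zero_le_one hx j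
  simpa [show q = 0 by simpa using hq] using h

theorem hasFactorialCovers_gapSet {α : ℝ} (h0 : 0 ≤ α) (h1 : α ≤ 1) :
    HasFactorialCovers α (gapSet α) := by
  classical
  refine ⟨1, one_pos, fun j =>
    ⟨(Finset.range (2 ^ ⌊α * (j ! : ℝ)⌋₊)).image fun q : ℕ => (q / 2 ^ ⌊α * (j ! : ℝ)⌋₊ : ℝ),
      ?_, fun x hx => ?_⟩⟩
  · refine (Nat.cast_le.2 Finset.card_image_le).trans ?_
    rw [Finset.card_range, one_mul, Nat.cast_pow, Nat.cast_two, ← Real.rpow_natCast]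
    gcongr
    · norm_num
    · exact Nat.floor_le (by positivity)
  · obtain ⟨q, hq, h, h'⟩ := exists_dyadic_near_of_mem_gapSet h1 hx j
    refine ⟨_, Finset.mem_image_of_mem _ (Finset.mem_range.2 hq), ?_⟩
    rw [Real.dist_eq, abs_le]
    have : (0 : ℝ) < 1 / 2 ^ (j !) := by positivity
    constructor <;> linarith

theorem dimH_pi_gapSet {ι : Type*} [Fintype ι] {α : ι → ℝ} (h0 : ∀ i, 0 ≤ α i)
    (h1 : ∀ i, α i ≤ 1) :
    dimH (Set.univ.pi fun i => gapSet (α i)) = ENNReal.ofReal (∑ i, α i) := by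
  refine le_antisymm
    (HasFactorialCovers.pi fun i => hasFactorialCovers_gapSet (h0 i) (h1 i)).dimH_le ?_
  have hlow : ∀ ε > 0, ENNReal.ofReal (∑ i, (α i - ε)) ≤
      dimH (Set.univ.pi fun i => gapSet (α i)) := by
    intro ε hε
    choose C hC using fun i => exists_freeCount_factorialGaps_ge (h0 i) (h1 i) hε
    refine le_dimH_pi_zeroDigitSet (C := ∑ i, |C i|) _ fun i N => ?_
    refine le_trans ?_ (hC i N)
    have := Finset.single_le_sum (f := fun i => |C i|) (fun i _ => abs_nonneg _)
      (Finset.mem_univ i)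
    linarith [le_abs_self (C i)]
  have hcont : Tendsto (fun ε : ℝ => ENNReal.ofReal (∑ i, (α i - ε))) (𝓝[>] 0)
      (𝓝 (ENNReal.ofReal (∑ i, α i))) := by
    have : Continuous fun ε : ℝ => ENNReal.ofReal (∑ i, (α i - ε)) :=
      ENNReal.continuous_ofReal.comp (by fun_prop)
    simpa using (this.tendsto 0).mono_left nhdsWithin_le_nhds
  exact le_of_tendsto hcont (by filter_upwards [self_mem_nhdsWithin] with ε hε using hlow ε hε)

/-- The dimension drop behind the planar examples: if the gaps of `x`, `y`, `t` are compatible,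
the numbers `y + t * x` cluster near an arithmetic progression at every factorial scale. -/
theorem hasFactorialCovers_add_mul_gapSet {κ μ t : ℝ} (hκ : 0 ≤ κ) (hμ : 0 ≤ μ) (h : κ + μ ≤ 1)
    (ht : t ∈ gapSet μ) :
    HasFactorialCovers (κ + μ) ((fun p : ℝ × ℝ => p.2 + t * p.1) '' gapSet κ ×ˢ gapSet (κ + μ)) := by
  classical
  -- Truncating each of `x`, `y` and `t` costs one error of at most `2 ^ (-j!)`, all factors being
  -- at most `1`.
  refine ⟨3, three_pos, fun j => ?_⟩
  obtain ⟨b, hb, hb1, hb2⟩ := exists_dyadic_near_of_mem_gapSet (by linarith) ht j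
  have ht1 := gapSet_subset_Icc _ ht
  have hKM : ⌊κ * (j ! : ℝ)⌋₊ + ⌊μ * (j ! : ℝ)⌋₊ ≤ ⌊(κ + μ) * (j ! : ℝ)⌋₊ := by
    refine Nat.le_floor ?_
    push_cast
    rw [add_mul]
    exact add_le_add (Nat.floor_le (by positivity)) (Nat.floor_le (by positivity))
  have hS : (⌊(κ + μ) * (j ! : ℝ)⌋₊ : ℝ) ≤ (κ + μ) * (j ! : ℝ) := Nat.floor_le (by positivity)
  have hδ : (0 : ℝ) < 1 / 2 ^ (j !) := by positivity
  have hx' := fun x hx => exists_dyadic_near_of_mem_gapSet (α := κ) (x := x) (by linarith) hx j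
  have hy' := fun y hy => exists_dyadic_near_of_mem_gapSet (α := κ + μ) (x := y) h hy j
  generalize ⌊κ * (j ! : ℝ)⌋₊ = K at *
  generalize ⌊μ * (j ! : ℝ)⌋₊ = M at *
  generalize ⌊(κ + μ) * (j ! : ℝ)⌋₊ = S at *
  -- As `K + M ≤ S`, the truncated product and the truncated `y` are both multiples of `2 ^ (-S)`
  -- below `1`, so their sum has fewer than `2 * 2 ^ S` possible values.
  refine ⟨(Finset.range (2 * 2 ^ S)).image fun q : ℕ => (q / 2 ^ S : ℝ), ?_, ?_⟩
  · refine (Nat.cast_le.2 Finset.card_image_le).trans ?_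
    rw [Finset.card_range, Nat.cast_mul, Nat.cast_pow, Nat.cast_two, ← Real.rpow_natCast]
    gcongr <;> norm_num
  · rintro _ ⟨⟨x, y⟩, ⟨hx, hy⟩, rfl⟩
    obtain ⟨a, ha, ha1, ha2⟩ := hx' x hx
    obtain ⟨c, hc, hc1, hc2⟩ := hy' y hy
    have hx1 := gapSet_subset_Icc _ hx
    have hab : a * b * 2 ^ (S - (K + M)) < 2 ^ S := by
      calc a * b * 2 ^ (S - (K + M)) < 2 ^ K * 2 ^ M * 2 ^ (S - (K + M)) := by
            gcongr
        _ = 2 ^ S := by rw [← pow_add, ← pow_add, Nat.add_sub_cancel' hKM]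
    refine ⟨_, Finset.mem_image_of_mem _ (Finset.mem_range.2
      (show c + a * b * 2 ^ (S - (K + M)) < 2 * 2 ^ S by omega)), ?_⟩
    have hsplit : ((c + a * b * 2 ^ (S - (K + M)) : ℕ) / 2 ^ S : ℝ) =
        c / 2 ^ S + (b / 2 ^ M) * (a / 2 ^ K) := by
      have : (2 : ℝ) ^ S = 2 ^ K * 2 ^ M * 2 ^ (S - (K + M)) := by
        rw [← pow_add, ← pow_add, Nat.add_sub_cancel' hKM]
      push_cast
      rw [add_div, this]
      field_simp
    rw [hsplit, Real.dist_eq]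
    have h3 : (3 : ℝ) / 2 ^ (j !) = 3 * (1 / 2 ^ (j !)) := by ring
    rw [h3]
    generalize (1 : ℝ) / 2 ^ (j !) = δ at *
    generalize (c / 2 ^ S : ℝ) = c' at *
    have ha0 : (0 : ℝ) ≤ a / 2 ^ K := by positivity
    have hb0 : (0 : ℝ) ≤ b / 2 ^ M := by positivity
    generalize (a / 2 ^ K : ℝ) = a' at *
    generalize (b / 2 ^ M : ℝ) = b' at *
    obtain ⟨-, ht1⟩ := ht1
    obtain ⟨-, hx1⟩ := hx1
    rw [abs_le]
    constructor <;> nlinarith [mul_nonneg (sub_nonneg.2 ha1) (sub_nonneg.2 ht1),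
      mul_nonneg (sub_nonneg.2 hb1) (sub_nonneg.2 hx1),
      mul_nonneg ha0 (sub_nonneg.2 hb1), mul_nonneg hb0 (sub_nonneg.2 ha1),
      mul_nonneg (sub_nonneg.2 ha1) (sub_nonneg.2 hb1)]

/-! ### Digit boxes in Euclidean space -/

/-- The points of `ℝⁿ` whose `q`-th coordinate lies in `gapSet (α q)`. -/
def gapBox {n : ℕ} (α : Fin n → ℝ) : Set (EuclideanSpace ℝ (Fin n)) := {z | ∀ q, z q ∈ gapSet (α q)}

theorem gapBox_eq_preimage {n : ℕ} (α : Fin n → ℝ) :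
    gapBox α = EuclideanSpace.equiv (Fin n) ℝ ⁻¹' Set.univ.pi fun q => gapSet (α q) := by
  ext z
  simp [gapBox]

theorem measurableSet_gapBox {n : ℕ} (α : Fin n → ℝ) : MeasurableSet (gapBox α) := by
  rw [gapBox_eq_preimage]
  exact (EuclideanSpace.equiv (Fin n) ℝ).continuous.measurable
    (.univ_pi fun q => (isCompact_gapSet _).measurableSet)

theorem dimH_gapBox {n : ℕ} {α : Fin n → ℝ} (h0 : ∀ q, 0 ≤ α q) (h1 : ∀ q, α q ≤ 1) :
    dimH (gapBox α) = ENNReal.ofReal (∑ q, α q) := by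
  rw [gapBox_eq_preimage, ContinuousLinearEquiv.dimH_preimage, dimH_pi_gapSet h0 h1]

theorem norm_le_sqrt_of_forall_mem_Icc {n : ℕ} {z : EuclideanSpace ℝ (Fin n)}
    (h : ∀ q, z q ∈ Set.Icc (0 : ℝ) 1) : ‖z‖ ≤ √n := by
  rw [EuclideanSpace.norm_eq]
  apply Real.sqrt_le_sqrt
  calc ∑ q, ‖z q‖ ^ 2 ≤ ∑ _q : Fin n, (1 : ℝ) := by
        refine Finset.sum_le_sum fun q _ => ?_
        rw [Real.norm_eq_abs, sq_abs]
        obtain ⟨h0, h1⟩ := h q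
        nlinarith
    _ = n := by simp

/-! ### Covers of projections -/

theorem hasFactorialCovers_of_isBounded {E : Type*} [NormedAddCommGroup E] [NormedSpace ℝ E]
    [FiniteDimensional ℝ E] {S : Set E} (hS : Bornology.IsBounded S) :
    HasFactorialCovers (Module.finrank ℝ E) S := by
  let T : E ≃L[ℝ] (Fin (Module.finrank ℝ E) → ℝ) :=
    ContinuousLinearEquiv.ofFinrankEq (Module.finrank_fin_fun ℝ).symm
  obtain ⟨R, hR⟩ := (T.lipschitz.isBounded_image hS).exists_norm_le
  have hpi : HasFactorialCovers (∑ _i : Fin (Module.finrank ℝ E), (1 : ℝ))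
      (Set.univ.pi fun _ => Set.Icc (-R) R) :=
    HasFactorialCovers.pi fun _ => HasFactorialCovers.Icc_real _ _
  have h2 := (hpi.image T.symm.lipschitz).mono_set (E' := S) fun x hx =>
    ⟨T x, fun i _ => abs_le.1 ((norm_le_pi_norm (T x) i).trans (hR _ ⟨x, hx, rfl⟩)), by simp⟩
  simpa using h2

/-- If `A` lies in `Uᗮ + B • f` with `U ≤ V` of codimension at most `l` in `V`, the projection of
`A` to `V` is covered as efficiently as `ℝˡ × B`. -/
theorem hasFactorialCovers_image_starProjection {E : Type*} [NormedAddCommGroup E]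
    [InnerProductSpace ℝ E] [FiniteDimensional ℝ E] {U V : Submodule ℝ E} (hUV : U ≤ V) {l : ℕ}
    (hl : Module.finrank ℝ V ≤ Module.finrank ℝ U + l) {A : Set E} {B : Set ℝ} {γ R : ℝ}
    (hB : HasFactorialCovers γ B) (f : E)
    (hA : ∀ x ∈ A, ∃ w ∈ Uᗮ, ‖w‖ ≤ R ∧ ∃ c ∈ B, x = w + c • f) :
    HasFactorialCovers (l + γ) (V.starProjection '' A) := by
  -- Since `U ≤ V`, projecting to `V` maps `Uᗮ` into `L`, of dimension at most `l`; the projection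
  -- of `A` is then a Lipschitz image of part of a ball of `L` times `B`.
  set L : Submodule ℝ E := Uᗮ ⊓ V with hL
  have hLl : Module.finrank ℝ L ≤ l := by
    have := Submodule.finrank_add_inf_finrank_orthogonal hUV
    rw [← hL] at this
    omega
  have hball : HasFactorialCovers (l : ℝ) (Metric.closedBall (0 : L) R) :=
    (hasFactorialCovers_of_isBounded Metric.isBounded_closedBall).mono_exponent
      (by exact_mod_cast hLl)
  let g : L × ℝ →L[ℝ] E := L.subtypeL.comp (ContinuousLinearMap.fst ℝ L ℝ) +
    (ContinuousLinearMap.snd ℝ L ℝ).smulRight (V.starProjection f)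
  refine ((hball.prod hB).image g.lipschitz).mono_set ?_
  rintro _ ⟨x, hx, rfl⟩
  obtain ⟨w, hw, hwR, c, hc, rfl⟩ := hA x hx
  have hwL : V.starProjection w ∈ L := by
    refine ⟨(Submodule.mem_orthogonal _ _).2 fun u hu => ?_, Submodule.starProjection_apply_mem _ _⟩
    rw [← Submodule.inner_starProjection_left_eq_right,
      Submodule.starProjection_eq_self_iff.2 (hUV hu)]
    exact (Submodule.mem_orthogonal _ _).1 hw u hu
  refine ⟨(⟨_, hwL⟩, c), ⟨?_, hc⟩, ?_⟩
  · rw [mem_closedBall_zero_iff]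
    exact (V.norm_starProjection_apply_le w).trans hwR
  · simp [g]

/-! ### Graph charts of the Grassmannian -/

section Graph

variable {k h n : ℕ} (e : Fin k ⊕ Fin h ≃ Fin n)

/-- The `i`-th row of the matrix `[1 | M]`, with columns labelled through `e`. -/
noncomputable def graphRow (M : Fin k × Fin h → ℝ) (i : Fin k) : EuclideanSpace ℝ (Fin n) :=
  WithLp.toLp 2 fun q => Sum.elim (Pi.single i 1) (fun j => M (i, j)) (e.symm q)

@[simp]
theorem graphRow_inl (M : Fin k × Fin h → ℝ) (i i' : Fin k) :
    graphRow e M i (e (.inl i')) = (Pi.single i 1 : Fin k → ℝ) i' := by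
  simp [graphRow]

@[simp]
theorem graphRow_inr (M : Fin k × Fin h → ℝ) (i : Fin k) (j : Fin h) :
    graphRow e M i (e (.inr j)) = M (i, j) := by
  simp [graphRow]

theorem inner_graphRow (M : Fin k × Fin h → ℝ) (i : Fin k) (z : EuclideanSpace ℝ (Fin n)) :
    inner ℝ (graphRow e M i) z = z (e (.inl i)) + ∑ j, M (i, j) * z (e (.inr j)) := by
  rw [PiLp.inner_apply, ← e.sum_comp, Fintype.sum_sum_type]
  simp [Pi.single_apply, mul_comm]

theorem linearIndependent_graphRow (M : Fin k × Fin h → ℝ) :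
    LinearIndependent ℝ (graphRow e M) := by
  rw [Fintype.linearIndependent_iff]
  intro c hc i
  have := congrArg (fun z : EuclideanSpace ℝ (Fin n) => z (e (.inl i))) hc
  simpa [Pi.single_apply] using this

/-- The row space of `[1 | M]`. -/
noncomputable def graphSpace (M : Fin k × Fin h → ℝ) : EuclideanGrassmannian k n :=
  ⟨Submodule.span ℝ (Set.range (graphRow e M)), by
    rw [finrank_span_eq_card (linearIndependent_graphRow e M), Fintype.card_fin]⟩

theorem graphRow_mem (M : Fin k × Fin h → ℝ) (i : Fin k) : graphRow e M i ∈ (graphSpace e M).1 :=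
  Submodule.subset_span ⟨i, rfl⟩

theorem apply_inr_of_mem_graphSpace {M : Fin k × Fin h → ℝ} {z : EuclideanSpace ℝ (Fin n)}
    (hz : z ∈ (graphSpace e M).1) (j : Fin h) :
    z (e (.inr j)) = ∑ i, z (e (.inl i)) * M (i, j) := by
  induction hz using Submodule.span_induction with
  | mem z hz =>
    obtain ⟨i, rfl⟩ := hz
    simp [Pi.single_apply]
  | zero => simp
  | add x y _ _ hx hy => simp [hx, hy, add_mul, Finset.sum_add_distrib]
  | smul c x _ hx => simp [hx, Finset.mul_sum, mul_assoc]

/-- Project a row of `[1 | M]` to the other plane. It moves by at most its norm times the distance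
of the planes, and the image satisfies the linear relations given by `M'`; comparing coordinates
bounds the entries of `M - M'`. -/
theorem dist_le_mul_dist_graphSpace {M M' : Fin k × Fin h → ℝ} (hM : ∀ p, M p ∈ Set.Icc (0 : ℝ) 1)
    (hM' : ∀ p, M' p ∈ Set.Icc (0 : ℝ) 1) :
    dist M M' ≤ (1 + k) * √n * dist (graphSpace e M) (graphSpace e M') := by
  rw [dist_pi_le_iff (by positivity)]
  rintro ⟨i, j⟩
  set v := graphRow e M i with hv
  set z := (graphSpace e M').proj v with hz
  have hvn : ‖v‖ ≤ √n := by
    refine norm_le_sqrt_of_forall_mem_Icc fun q => ?_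
    obtain ⟨p, rfl⟩ := e.surjective q
    rcases p with i' | j'
    · rw [hv, graphRow_inl, Pi.single_apply]
      split_ifs <;> simp
    · rw [hv, graphRow_inr]
      exact hM _
  have hvz : ‖v - z‖ ≤ √n * dist (graphSpace e M) (graphSpace e M') := by
    have : v - z = ((graphSpace e M).proj - (graphSpace e M').proj) v := by
      rw [sub_apply, ← hz, EuclideanGrassmannian.proj,
        Submodule.starProjection_eq_self_iff.2 (graphRow_mem e M i)]
    rw [this, EuclideanGrassmannian.dist_eq, mul_comm]
    exact (ContinuousLinearMap.le_opNorm _ _).trans (by gcongr)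
  have hcoord : ∀ q, |v q - z q| ≤ ‖v - z‖ := fun q => PiLp.norm_apply_le (v - z) q
  have hzV : z ∈ (graphSpace e M').1 := Submodule.starProjection_apply_mem _ _
  have hMv : M' (i, j) = ∑ i', v (e (.inl i')) * M' (i', j) := by
    simp [hv, Pi.single_apply]
  have hdiff : M (i, j) - M' (i, j) = (v (e (.inr j)) - z (e (.inr j))) -
      ∑ i', (v (e (.inl i')) - z (e (.inl i'))) * M' (i', j) := by
    simp only [sub_mul, Finset.sum_sub_distrib]
    rw [← hMv, apply_inr_of_mem_graphSpace e hzV j, hv, graphRow_inr]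
    ring
  rw [Real.dist_eq, hdiff]
  calc _ ≤ |v (e (.inr j)) - z (e (.inr j))| +
        |∑ i', (v (e (.inl i')) - z (e (.inl i'))) * M' (i', j)| := abs_sub _ _
    _ ≤ ‖v - z‖ + ∑ _i' : Fin k, ‖v - z‖ := by
        refine add_le_add (hcoord _) ((Finset.abs_sum_le_sum_abs _ _).trans
          (Finset.sum_le_sum fun i' _ => ?_))
        rw [abs_mul, abs_of_nonneg (hM' _).1]
        exact (mul_le_of_le_one_right (abs_nonneg _) (hM' _).2).trans (hcoord _)
    _ = (1 + k) * ‖v - z‖ := by simp; ring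
    _ ≤ _ := by rw [mul_assoc]; gcongr

theorem le_dimH_image_graphSpace {a : Fin k × Fin h → ℝ} (h0 : ∀ p, 0 ≤ a p)
    (h1 : ∀ p, a p ≤ 1) :
    ENNReal.ofReal (∑ p, a p) ≤
      dimH (graphSpace e '' Set.univ.pi fun p => gapSet (a p)) := by
  rw [← dimH_pi_gapSet h0 h1]
  set S : Set (Fin k × Fin h → ℝ) := Set.univ.pi fun p => gapSet (a p)
  have hS : ∀ M ∈ S, ∀ p, M p ∈ Set.Icc (0 : ℝ) 1 := fun M hM p =>
    gapSet_subset_Icc _ (hM p (Set.mem_univ p))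
  have hanti : AntilipschitzWith ((1 + k) * NNReal.sqrt n) fun M : S => graphSpace e M := by
    refine AntilipschitzWith.of_le_mul_dist fun M M' => ?_
    simpa [Subtype.dist_eq] using dist_le_mul_dist_graphSpace e (hS _ M.2) (hS _ M'.2)
  calc dimH S = dimH (Subtype.val '' (Set.univ : Set S)) := by simp
    _ = dimH (Set.univ : Set S) := isometry_subtype_coe.dimH_image _
    _ ≤ dimH ((fun M : S => graphSpace e M) '' Set.univ) := hanti.le_dimH_image _
    _ = _ := by
      rw [Set.image_univ, Set.image_eq_range]

/-- Lower bound for `T(a, s)` from a digit box in `ℝⁿ` and a digit box of graphs: it suffices that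
for each graph the pairings of the box with the rows `i ≥ l` vanish, except that the `l`-th one
ranges in an efficiently covered set. -/
theorem le_exceptionalDim_of_gapBox (e : Fin k ⊕ Fin h ≃ Fin n) {α : Fin k ⊕ Fin h → ℝ} {a : Fin k × Fin h → ℝ}
    (hα0 : ∀ p, 0 ≤ α p) (hα1 : ∀ p, α p ≤ 1) (ha0 : ∀ p, 0 ≤ a p) (ha1 : ∀ p, a p ≤ 1)
    {l : Fin k} {γ s : ℝ} (hγ : l + γ < s) (hs : 0 < s)
    (H : ∀ M : Fin k × Fin h → ℝ, (∀ p, M p ∈ gapSet (a p)) → ∃ B : Set ℝ,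
      HasFactorialCovers γ B ∧ ∀ x : Fin k ⊕ Fin h → ℝ, (∀ p, x p ∈ gapSet (α p)) →
        ∃ c ∈ B, |c| ≤ 2 ∧ ∀ i, l ≤ i →
          x (.inl i) + ∑ j, M (i, j) * x (.inr j) = if i = l then c else 0) :
    ENNReal.ofReal (∑ p, a p) ≤ exceptionalDim k n (∑ p, α p) s := by
  refine (le_dimH_image_graphSpace e ha0 ha1).trans ?_
  have hdim : dimH (gapBox fun q => α (e.symm q)) = ENNReal.ofReal (∑ p, α p) := by
    rw [dimH_gapBox (fun q => hα0 _) fun q => hα1 _, e.symm.sum_comp]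
  refine le_trans (dimH_mono ?_) (le_iSup₂_of_le (gapBox fun q => α (e.symm q))
    (measurableSet_gapBox _) (le_iSup_of_le hdim le_rfl))
  rintro _ ⟨M, hM, rfl⟩
  obtain ⟨B, hB, HB⟩ := H M fun p => hM p (Set.mem_univ p)
  set U : Submodule ℝ (EuclideanSpace ℝ (Fin n)) :=
    Submodule.span ℝ (Set.range fun i : {i : Fin k // l ≤ i} => graphRow e M i) with hU
  have hUV : U ≤ (graphSpace e M).1 :=
    Submodule.span_mono (by rintro _ ⟨i, rfl⟩; exact ⟨i, rfl⟩)
  have hfin : Module.finrank ℝ (graphSpace e M).1 ≤ Module.finrank ℝ U + l := by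
    have hli : LinearIndependent ℝ fun i : {i : Fin k // l ≤ i} => graphRow e M i :=
      (linearIndependent_graphRow e M).comp _ Subtype.val_injective
    rw [(graphSpace e M).2, hU, finrank_span_eq_card hli, Fintype.card_subtype]
    have : (Finset.univ.filter fun i : Fin k => l ≤ i) = Finset.Ici l := by ext; simp
    rw [this, Fin.card_Ici]
    omega
  have hcov := hasFactorialCovers_image_starProjection hUV hfin
    (A := gapBox fun q => α (e.symm q)) (R := √n + 2) hB
    (EuclideanSpace.single (e (.inl l)) 1) fun x hx => by
      obtain ⟨c, hc, hc2, hrow⟩ := HB (fun p => x (e p)) fun p => by simpa using hx (e p)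
      -- This unit vector pairs to `1` with row `l` and to `0` with every other row, so subtracting
      -- `c` times it makes all pairings with rows `i ≥ l` vanish.
      refine ⟨x - c • EuclideanSpace.single (e (.inl l)) 1, ?_, ?_, c, hc, by simp⟩
      · rw [Submodule.mem_orthogonal]
        intro u hu
        induction hu using Submodule.span_induction with
        | mem u hu =>
          obtain ⟨i, rfl⟩ := hu
          have hrow' := hrow i i.2
          rw [inner_sub_right, inner_graphRow, hrow', inner_smul_right, inner_graphRow]
          by_cases hil : (i : Fin k) = l
          · simp [hil]
          · simp [hil]
        | zero => simp
        | add u v _ _ hu hv => rw [inner_add_left, hu, hv, add_zero]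
        | smul r u _ hu => rw [inner_smul_left, hu, mul_zero]
      · refine (norm_sub_le _ _).trans (add_le_add
          (norm_le_sqrt_of_forall_mem_Icc fun q => gapSet_subset_Icc _ (hx q)) ?_)
        rw [norm_smul]
        simpa using hc2
  exact hcov.dimH_le.trans_lt ((ENNReal.ofReal_lt_ofReal_iff hs).2 hγ)

end Graph

/-! ### Cylinder and planar examples, and the four lower bounds -/

theorem sum_fin_ite_lt {k l : ℕ} (hl : l ≤ k) (x z : ℝ) :
    ∑ i : Fin k, (if (i : ℕ) < l then x else z) = l * x + (k - l) * z := by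
  obtain ⟨r, rfl⟩ := Nat.exists_eq_add_of_le hl
  rw [Fin.sum_univ_eq_sum_range (fun i => if i < l then x else z), Finset.sum_range_add,
    Finset.sum_congr rfl fun i hi => if_pos (Finset.mem_range.1 hi)]
  simp

theorem sum_fin_ite_lt_ite_eq {k l : ℕ} (hl : l < k) (x y z : ℝ) :
    ∑ i : Fin k, (if (i : ℕ) < l then x else if (i : ℕ) = l then y else z) =
      l * x + y + (k - l - 1) * z := by
  have : ∀ i : Fin k, (if (i : ℕ) < l then x else if (i : ℕ) = l then y else z) =
      (if (i : ℕ) < l then x else z) + if i = ⟨l, hl⟩ then y - z else 0 := by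
    intro i
    simp only [Fin.ext_iff]
    split_ifs <;> first | omega | ring
  rw [Finset.sum_congr rfl fun i _ => this i, Finset.sum_add_distrib, sum_fin_ite_lt hl.le,
    Finset.sum_ite_eq']
  simp
  ring

/-- Lower bound from the product of a linear subspace with a subset of a line. -/
theorem le_exceptionalDim_cylinder {k h n l m : ℕ} (hn : k + h = n) (hl : l < k) (hlm : l ≤ m)
    (hm : m ≤ l + h) {β s : ℝ} (hβ0 : 0 ≤ β) (hβ1 : β ≤ 1) (hs : l + β < s) :
    ENNReal.ofReal (k * h - (m - l) * (k - l)) ≤ exceptionalDim k n (m + β) s := by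
  subst hn
  obtain ⟨p, rfl⟩ := Nat.exists_eq_add_of_le hlm
  have hp : p ≤ h := by omega
  -- Here `p = m - l`. Rows before `l` of `M` are free; in the other rows, the entries facing the
  -- `p` full coordinates are zero, so only the `β`-dimensional coordinate survives in row `l`.
  have key := le_exceptionalDim_of_gapBox (finSumFinEquiv (m := k) (n := h))
    (α := Sum.elim (fun i => if (i : ℕ) < l then 1 else if (i : ℕ) = l then β else 0)
      fun j => if (j : ℕ) < p then 1 else 0)
    (a := fun q => if (q.1 : ℕ) < l then 1 else if (q.2 : ℕ) < p then 0 else 1)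
    (l := ⟨l, hl⟩) (γ := β) (s := s)
    (by rintro (i | j) <;> simp only [Sum.elim_inl, Sum.elim_inr] <;> split_ifs <;> linarith)
    (by rintro (i | j) <;> simp only [Sum.elim_inl, Sum.elim_inr] <;> split_ifs <;> linarith)
    (by intro q; split_ifs <;> simp) (by intro q; split_ifs <;> simp)
    hs (by have := (Nat.cast_nonneg l : (0 : ℝ) ≤ l); linarith) ?_
  · convert key using 1
    · rw [Fintype.sum_prod_type]
      congr 1
      have : ∀ i : Fin k, (∑ j : Fin h,
          if (i : ℕ) < l then (1 : ℝ) else if (j : ℕ) < p then 0 else 1) =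
          if (i : ℕ) < l then (h : ℝ) else h - p := by
        intro i
        split_ifs with hi
        · simp
        · rw [sum_fin_ite_lt hp]
          ring
      rw [Finset.sum_congr rfl fun i _ => this i, sum_fin_ite_lt hl.le]
      push_cast
      ring
    · rw [Fintype.sum_sum_type]
      simp only [Sum.elim_inl, Sum.elim_inr]
      rw [sum_fin_ite_lt_ite_eq hl, sum_fin_ite_lt hp]
      push_cast
      congr 1
      ring
  · intro M hM
    refine ⟨gapSet β, hasFactorialCovers_gapSet hβ0 hβ1, fun x hx =>
      ⟨x (.inl ⟨l, hl⟩), by simpa using hx (.inl ⟨l, hl⟩), ?_, fun i hi => ?_⟩⟩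
    · obtain ⟨h0, h1⟩ := gapSet_subset_Icc _ (hx (.inl ⟨l, hl⟩))
      rw [abs_of_nonneg h0]
      linarith
    · have hi' : ¬ (i : ℕ) < l := not_lt.2 hi
      rw [Finset.sum_eq_zero, add_zero]
      · split_ifs with hil
        · rw [hil]
        · have := hx (.inl i)
          simp only [Sum.elim_inl, if_neg hi', if_neg fun h : (i : ℕ) = l => hil (Fin.ext h)]
            at this
          exact gapSet_zero this
      · intro j _
        have h1 := hM (i, j)
        have h2 := hx (.inr j)
        simp only [if_neg hi', Sum.elim_inr] at h1 h2
        split_ifs at h1 h2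
        · rw [show M (i, j) = 0 from gapSet_zero h1, zero_mul]
        · rw [show x (.inr j) = 0 from gapSet_zero h2, mul_zero]

/-- Lower bound from the product of a linear subspace with a planar set having many small
projections. -/
theorem le_exceptionalDim_planar {k h n l m : ℕ} (hn : k + h = n) (hl : l < k) (hlm : l ≤ m)
    (hm : m < l + h) {κ μ s : ℝ} (hκ : 0 ≤ κ) (hμ : 0 ≤ μ) (hκμ : κ + μ ≤ 1)
    (hs : l + (κ + μ) < s) :
    ENNReal.ofReal (k * h - (m + 1 - l) * (k - l) + μ) ≤
      exceptionalDim k n (m + (2 * κ + μ)) s := by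
  subst hn
  obtain ⟨p, rfl⟩ := Nat.exists_eq_add_of_le hlm
  have hp : p < h := by omega
  -- As for the cylinder, but column `p` now carries a `κ`-dimensional coordinate. Its entry in row
  -- `l` ranges in `gapSet μ` and plays the role of `t`; the entries below it are zero.
  have key := le_exceptionalDim_of_gapBox (finSumFinEquiv (m := k) (n := h))
    (α := Sum.elim (fun i => if (i : ℕ) < l then 1 else if (i : ℕ) = l then κ + μ else 0)
      fun j => if (j : ℕ) < p then 1 else if (j : ℕ) = p then κ else 0)
    (a := fun q => if (q.1 : ℕ) < l then 1 else if (q.2 : ℕ) < p then 0 else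
      if (q.2 : ℕ) = p then (if (q.1 : ℕ) = l then μ else 0) else 1)
    (l := ⟨l, hl⟩) (γ := κ + μ) (s := s)
    (by rintro (i | j) <;> simp only [Sum.elim_inl, Sum.elim_inr] <;> split_ifs <;> linarith)
    (by rintro (i | j) <;> simp only [Sum.elim_inl, Sum.elim_inr] <;> split_ifs <;> linarith)
    (by intro q; split_ifs <;> linarith) (by intro q; split_ifs <;> linarith)
    hs (by have := (Nat.cast_nonneg l : (0 : ℝ) ≤ l); linarith) ?_
  · convert key using 1
    · rw [Fintype.sum_prod_type]
      congr 1
      have : ∀ i : Fin k, (∑ j : Fin h, if (i : ℕ) < l then (1 : ℝ) else if (j : ℕ) < p then 0 else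
          if (j : ℕ) = p then (if (i : ℕ) = l then μ else 0) else 1) =
          if (i : ℕ) < l then (h : ℝ) else if (i : ℕ) = l then μ + (h - p - 1)
            else (h - p - 1) := by
        intro i
        by_cases hi : (i : ℕ) < l
        · simp [hi]
        · simp only [if_neg hi]
          rw [sum_fin_ite_lt_ite_eq hp]
          split_ifs <;> ring
      rw [Finset.sum_congr rfl fun i _ => this i, sum_fin_ite_lt_ite_eq hl]
      push_cast
      ring
    · rw [Fintype.sum_sum_type]
      simp only [Sum.elim_inl, Sum.elim_inr]
      rw [sum_fin_ite_lt_ite_eq hl, sum_fin_ite_lt_ite_eq hp]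
      push_cast
      congr 1
      ring
  · intro M hM
    have ht : M (⟨l, hl⟩, ⟨p, hp⟩) ∈ gapSet μ := by simpa using hM (⟨l, hl⟩, ⟨p, hp⟩)
    refine ⟨_, hasFactorialCovers_add_mul_gapSet hκ hμ hκμ ht, fun x hx => ?_⟩
    have hx1 : x (.inr ⟨p, hp⟩) ∈ gapSet κ := by simpa using hx (.inr ⟨p, hp⟩)
    have hx2 : x (.inl ⟨l, hl⟩) ∈ gapSet (κ + μ) := by simpa using hx (.inl ⟨l, hl⟩)
    refine ⟨_, ⟨(x (.inr ⟨p, hp⟩), x (.inl ⟨l, hl⟩)), ⟨hx1, hx2⟩, rfl⟩, ?_, fun i hi => ?_⟩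
    · obtain ⟨a0, a1⟩ := gapSet_subset_Icc _ hx1
      obtain ⟨b0, b1⟩ := gapSet_subset_Icc _ hx2
      obtain ⟨c0, c1⟩ := gapSet_subset_Icc _ ht
      dsimp only
      rw [abs_of_nonneg (by positivity)]
      nlinarith
    · have hi' : ¬ (i : ℕ) < l := not_lt.2 hi
      rw [Finset.sum_eq_single ⟨p, hp⟩]
      · split_ifs with hil
        · rw [hil]
        · have hil' : (i : ℕ) ≠ l := fun h => hil (Fin.ext h)
          have h1 := hx (.inl i)
          have h2 := hM (i, ⟨p, hp⟩)
          simp only [Sum.elim_inl, if_neg hi', if_neg hil', lt_irrefl, if_false, if_true] at h1 h2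
          rw [show x (.inl i) = 0 from gapSet_zero h1,
            show M (i, ⟨p, hp⟩) = 0 from gapSet_zero h2, zero_mul, add_zero]
      · intro j _ hj
        have hj' : (j : ℕ) ≠ p := fun h => hj (Fin.ext h)
        have h1 := hM (i, j)
        have h2 := hx (.inr j)
        simp only [if_neg hi', if_neg hj', Sum.elim_inr] at h1 h2
        split_ifs at h1 h2
        · rw [show M (i, j) = 0 from gapSet_zero h1, zero_mul]
        · rw [show x (.inr j) = 0 from gapSet_zero h2, mul_zero]
      · simp

/-- The planar lower bound with the parameters expressed through the dimensions. -/
theorem le_exceptionalDim_planar_of_lt {k h n l m : ℕ} (hn : k + h = n) (hl : l < k) (hlm : l ≤ m)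
    (hm : m < l + h) {β γ : ℝ} (hβ : β / 2 < γ) (hγβ : γ ≤ β) (hγ : γ ≤ 1) :
    ENNReal.ofReal (k * h - (m + 1 - l) * (k - l) + 2 * γ - β) ≤
      exceptionalDim k n (m + β) (l + γ) := by
  -- The planar bound requires `κ + μ` strictly below `γ`, so it is applied with `γ' < γ` and the
  -- limit is taken.
  have hcont : Tendsto (fun γ' : ℝ => ENNReal.ofReal
      (k * h - (m + 1 - l) * (k - l) + (2 * γ' - β))) (𝓝[<] γ)
      (𝓝 (ENNReal.ofReal (k * h - (m + 1 - l) * (k - l) + (2 * γ - β)))) := by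
    have : Continuous fun γ' : ℝ => ENNReal.ofReal
        (k * h - (m + 1 - l) * (k - l) + (2 * γ' - β)) :=
      ENNReal.continuous_ofReal.comp (by fun_prop)
    exact (this.tendsto γ).mono_left nhdsWithin_le_nhds
  rw [add_sub_assoc]
  refine le_of_tendsto hcont ?_
  filter_upwards [Ioo_mem_nhdsLT hβ] with γ' hγ'
  -- The solution of `κ + μ = γ'` and `2κ + μ = β`; it is nonnegative because `β / 2 < γ' < γ ≤ β`.
  have := le_exceptionalDim_planar hn hl hlm hm (κ := β - γ') (μ := 2 * γ' - β) (s := l + γ)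
    (by linarith [hγ'.2]) (by linarith [hγ'.1]) (by linarith [hγ'.2]) (by linarith [hγ'.2])
  rwa [show 2 * (β - γ') + (2 * γ' - β) = β by ring] at this

theorem proposition6p9 (n k : ℕ) (hk : 0 < k) (hkn : k < n)
    (a s : ℝ) (ha : 0 < a) (han : a < n) (hs : 0 < s) (hsmin : s ≤ min (k : ℝ) a)
    (m l : ℕ) (β γ : ℝ) (hβ : β ∈ Set.Ioc (0 : ℝ) 1) (hγ : γ ∈ Set.Ioc (0 : ℝ) 1)
    (ham : a = m + β) (hsl : s = l + γ) :
    -- Type 1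
    (1 ≤ m → (m : ℤ) ≤ n + l - k → (β + 1) / 2 < γ →
      ENNReal.ofReal
          ((grassmannianDim (k - l) (n - m) + grassmannianDim l (n - (k - l)) : ℤ)
            + 2 * γ - (β + 1)) ≤ exceptionalDim k n a s ∧
      ((grassmannianDim (k - l) (n - m) + grassmannianDim l (n - (k - l)) : ℤ) : ℝ)
            + 2 * γ - (β + 1)
        = (k : ℝ) * (n - k) - (m - l) * (k - l) + 2 * γ - (β + 1)) ∧
    -- Type 2
    ((m : ℤ) ≤ n + l - k → β < γ →
      ENNReal.ofReal
          ((grassmannianDim (k - l) (n - m) + grassmannianDim l (n - (k - l)) : ℤ))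
        ≤ exceptionalDim k n a s ∧
      ((grassmannianDim (k - l) (n - m) + grassmannianDim l (n - (k - l)) : ℤ) : ℝ)
        = (k : ℝ) * (n - k) - (m - l) * (k - l)) ∧
    -- Type 3
    ((m : ℤ) ≤ n + l - k - 1 → β / 2 < γ →
      ENNReal.ofReal
          ((grassmannianDim (k - l) (n - m - 1) + grassmannianDim l (n - (k - l)) : ℤ)
            + 2 * γ - β) ≤ exceptionalDim k n a s ∧
      ((grassmannianDim (k - l) (n - m - 1) + grassmannianDim l (n - (k - l)) : ℤ) : ℝ)
            + 2 * γ - β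
        = (k : ℝ) * (n - k) - (m + 1 - l) * (k - l) + 2 * γ - β) ∧
    -- Type 4
    (1 ≤ l → (m : ℤ) ≤ n + l - k - 1 →
      ENNReal.ofReal
          ((grassmannianDim (k - (l - 1)) (n - m)
            + grassmannianDim (l - 1) (n - (k - l + 1)) : ℤ))
        ≤ exceptionalDim k n a s ∧
      ((grassmannianDim (k - (l - 1)) (n - m)
            + grassmannianDim (l - 1) (n - (k - l + 1)) : ℤ) : ℝ)
        = (k : ℝ) * (n - k) - (m - l + 1) * (k - l + 1)) := by
  obtain ⟨h, rfl⟩ := Nat.exists_eq_add_of_le hkn.le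
  obtain ⟨hβ0, hβ1⟩ := hβ
  obtain ⟨hγ0, hγ1⟩ := hγ
  obtain ⟨hsk, hsa⟩ := le_min_iff.1 hsmin
  subst ham hsl
  have hlk : l < k := by
    have : (l : ℝ) < k := by linarith
    exact_mod_cast this
  have hlm : l ≤ m := by
    have : (l : ℝ) < m + 1 := by linarith
    exact Nat.lt_succ_iff.1 (by exact_mod_cast this)
  have hlm' : β < γ → l < m := fun hβγ => by
    have : (l : ℝ) < m := by linarith
    exact_mod_cast this
  have hd : ((grassmannianDim (k - l) ((k + h : ℕ) - m) +
      grassmannianDim l ((k + h : ℕ) - (k - l)) : ℤ) : ℝ)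
      = (k : ℝ) * ((k + h : ℕ) - k) - (m - l) * (k - l) := by
    simp only [grassmannianDim]
    push_cast
    ring
  have hd3 : ((grassmannianDim (k - l) ((k + h : ℕ) - m - 1) +
      grassmannianDim l ((k + h : ℕ) - (k - l)) : ℤ) : ℝ)
      = (k : ℝ) * ((k + h : ℕ) - k) - (m + 1 - l) * (k - l) := by
    simp only [grassmannianDim]
    push_cast
    ring
  have hd4 : ((grassmannianDim (k - (l - 1)) ((k + h : ℕ) - m) +
      grassmannianDim (l - 1) ((k + h : ℕ) - (k - l + 1)) : ℤ) : ℝ)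
      = (k : ℝ) * ((k + h : ℕ) - k) - (m - l + 1) * (k - l + 1) := by
    simp only [grassmannianDim]
    push_cast
    ring
  have hkh : (((k + h : ℕ) : ℝ) - k) = h := by push_cast; ring
  rw [hd, hd3, hd4, hkh]
  have type1 : 1 ≤ m → m ≤ l + h → (β + 1) / 2 < γ →
      ENNReal.ofReal (k * h - (m - l) * (k - l) + 2 * γ - (β + 1)) ≤
        exceptionalDim k (k + h) (m + β) (l + γ) := by
    intro hm1 hm hγβ
    have hlm1 := hlm' (by linarith)
    -- One full dimension is moved into the planar factor, which then has dimension `β + 1 ∈ (1,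
    -- 2]`.
    obtain ⟨m', rfl⟩ := Nat.exists_eq_add_of_le' hm1
    have := le_exceptionalDim_planar_of_lt (β := β + 1) rfl hlk (Nat.lt_succ_iff.1 hlm1)
      (Nat.lt_of_succ_le hm) hγβ (by linarith) hγ1
    push_cast
    rwa [add_assoc (m' : ℝ) 1 β, add_comm 1 β]
  have type2 : m ≤ l + h → β < γ → ENNReal.ofReal (k * h - (m - l) * (k - l)) ≤
      exceptionalDim k (k + h) (m + β) (l + γ) := fun hm hβγ =>
    le_exceptionalDim_cylinder rfl hlk hlm hm hβ0.le hβ1 (by linarith)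
  refine ⟨fun hm1 hm hγβ => ⟨type1 hm1 (by omega) hγβ, rfl⟩,
    fun hm hβγ => ⟨type2 (by omega) hβγ, rfl⟩, fun hm hβγ => ⟨?_, rfl⟩, fun hl1 hm => ⟨?_, rfl⟩⟩
  · have hmh : m < l + h := by omega
    rcases le_or_gt γ β with hle | hlt
    · exact le_exceptionalDim_planar_of_lt rfl hlk hlm hmh hβγ hle hγ1
    -- For `γ > β`, Type 2 exceeds the required bound by `(k - l) - (2γ - β)`. If this is negative,
    -- `2γ - β < 2` forces `k = l + 1`, and Type 1 then gives exactly the required value.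
    rcases le_or_gt (2 * γ - β) (k - l) with hsmall | hbig
    · refine le_trans (ENNReal.ofReal_le_ofReal ?_) (type2 hmh.le hlt)
      linarith
    · have hkl : k = l + 1 := by
        have : (k : ℝ) < l + 2 := by linarith
        have : k < l + 2 := by exact_mod_cast this
        omega
      have hkl' : (k : ℝ) = l + 1 := by exact_mod_cast hkl
      refine le_trans (ENNReal.ofReal_le_ofReal ?_)
        (type1 (by have := hlm' hlt; omega) hmh.le (by linarith))
      rw [hkl']
      linarith
  · obtain ⟨l', rfl⟩ := Nat.exists_eq_add_of_le' hl1
    -- With `l - 1` in place of `l` the cylinder needs only `β < 1 + γ`, which always holds.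
    have := le_exceptionalDim_cylinder (l := l') (m := m) (h := h) (s := (l' + 1 : ℕ) + γ) rfl
      (by omega : l' < k) (by omega) (by omega) hβ0.le hβ1 (by push_cast; linarith)
    refine le_trans (ENNReal.ofReal_le_ofReal (le_of_eq ?_)) this
    push_cast
    ring
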